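/- For sets $K_1, K_2 \subseteq \mathbb{C}$ write $K_1K_2 = \{ab : a \in K_1,\ b \in K_2\}$, and for $z, w \in \mathbb{C}$ let $K(z,w)$ denote the closed line segment joining $z$ and $w$. A set $S \subseteq \mathbb{C}$ is called star-shaped if there is a point $p \in S$ such that $K(p,q) \subseteq S$ for all $q \in S$. An extreme point of a compact convex set $S \subseteq \mathbb{C}$ is a point of $S$ that is not the midpoint of two different points of $S$. **Theorem 6.1.** Let $K_1, K_2 \subseteq \mathbb{C}$ be compact convex sets. Then $K_1K_2$ is star-shaped if and only if there is $p \in K_1K_2$ such that $K(p, ab) \subseteq K_1K_2$ for all extreme points $a$ of $K_1$ and all extreme points $b$ of $K_2$. -/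

import Mathlib

open scoped Pointwise

/-- A set `S` of complex numbers is star-shaped if it has a star center: a point `p ∈ S` such that
the segment joining `p` to any point of `S` lies in `S`. -/
def IsStarShaped (S : Set ℂ) : Prop :=
  ∃ p ∈ S, StarConvex ℝ p S

/-! If a factor contains 0, the product is star-shaped about 0. Otherwise put S = K₁K₂. It misses a
closed ray from 0, and it is radially convex: between two of its points on one ray, a path of
products can be kept on that ray's line (`mem_mul_of_smul_mem_mul`). For fixed b ∈ K₂, the a ∈ K₁
with K(p, ab) ⊆ S form a convex set: the triangle p, xb, yb has its boundary in S, it omits 0 since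
the missed ray would otherwise cross that boundary, and radial convexity fills it in. This set is
also closed, so by Krein–Milman the extreme points of K₁ suffice. Exchanging the factors then treats
K₂. -/

/-- Moving from a point of the nonnegative orthant along a direction with some negative coordinate,
one leaves the orthant through a point with a vanishing coordinate. -/
theorem exists_nonneg_add_mul_eq_zero {w c : Fin 3 → ℝ} (hw : ∀ i, 0 ≤ w i)
    (hc : ∃ i, c i < 0) :
    ∃ t : ℝ, 0 ≤ t ∧ (∀ i, 0 ≤ w i + t * c i) ∧ ∃ i, w i + t * c i = 0 := by
  classical
  obtain ⟨j, hj⟩ := hc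
  -- The least ratio belongs to the coordinate that vanishes first.
  obtain ⟨i, hi, hmin⟩ := Finset.exists_min_image (Finset.univ.filter fun i => c i < 0)
    (fun i => w i / (-c i)) ⟨j, by simpa using hj⟩
  simp only [Finset.mem_filter, Finset.mem_univ, true_and] at hi hmin
  have ht : 0 ≤ w i / (-c i) := div_nonneg (hw i) (by linarith)
  refine ⟨w i / (-c i), ht, fun k => ?_, i, ?_⟩
  · rcases lt_or_ge (c k) 0 with hk | hk
    · have h := hmin k hk
      rw [le_div_iff₀ (by linarith)] at h
      linarith
    · exact add_nonneg (hw k) (mul_nonneg ht hk)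
  · have : c i ≠ 0 := hi.ne
    field_simp
    ring

/-- In the complex plane, a nonzero vector is proportional to some nontrivial combination, of total
weight zero, of the vertices of a triangle; the proportionality factor vanishes when the triangle is
degenerate. -/
theorem exists_weights_eq_smul (p q r v : ℂ) (hv : v ≠ 0) :
    ∃ κ : ℝ, ∃ l m : ℝ, 0 ≤ κ ∧ (l ≠ 0 ∨ m ≠ 0) ∧
      (l : ℂ) * (q - p) + m * (r - p) = κ * v := by
  set x := q - p
  set y := r - p
  by_cases hD : x.re * y.im - x.im * y.re = 0
  · by_cases hy : y = 0
    · exact ⟨0, 0, 1, le_rfl, by simp, by simp [hy]⟩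
    · refine ⟨0, Complex.normSq y, -(x.re * y.re + x.im * y.im), le_rfl,
        Or.inl (by simpa using hy), ?_⟩
      apply Complex.ext
      · simp [Complex.normSq_apply]
        linear_combination y.im * hD
      · simp [Complex.normSq_apply]
        linear_combination -y.re * hD
  -- Cramer's rule for v in the basis x, y.
  · set D := x.re * y.im - x.im * y.re with hDdef
    have h₁ : (v.re * y.im - v.im * y.re) / D * x.re + (x.re * v.im - x.im * v.re) / D * y.re
        = v.re := by
      field_simp
      rw [hDdef]; ring
    have h₂ : (v.re * y.im - v.im * y.re) / D * x.im + (x.re * v.im - x.im * v.re) / D * y.im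
        = v.im := by
      field_simp
      rw [hDdef]; ring
    refine ⟨1, (v.re * y.im - v.im * y.re) / D, (x.re * v.im - x.im * v.re) / D, zero_le_one,
      ?_, ?_⟩
    · by_contra! h
      rw [h.1, h.2] at h₁ h₂
      exact hv (Complex.ext (by simpa using h₁.symm) (by simpa using h₂.symm))
    · apply Complex.ext
      · simpa using h₁
      · simpa using h₂

/-- The ray from a point of a triangle in any direction meets the boundary of the triangle. -/
theorem exists_add_smul_mem_triangle_boundary {p q r x v : ℂ} (hv : v ≠ 0)
    (hx : x ∈ convexHull ℝ {p, q, r}) :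
    ∃ t : ℝ, 0 ≤ t ∧ x + t * v ∈ segment ℝ p q ∪ segment ℝ q r ∪ segment ℝ r p := by
  rw [convexHull_insert (by simp), convexHull_pair, mem_convexJoin] at hx
  obtain ⟨p', hp', y, ⟨e, f, he, hf, hef, rfl⟩, ⟨g, h, hg, hh, hgh, rfl⟩⟩ := hx
  rw [Set.mem_singleton_iff] at hp'
  subst hp'
  obtain ⟨κ, l, m, hκ, hlm, hrel⟩ := exists_weights_eq_smul p' q r v hv
  -- Barycentric coordinates move along a nonzero direction of sum zero, so one of them decreases.
  -- If κ = 0, the point stays put and already lies on the boundary.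
  obtain ⟨t, ht, hnn, i, hi⟩ :=
    exists_nonneg_add_mul_eq_zero (w := ![g, h * e, h * f]) (c := ![-(l + m), l, m])
      (by intro i; fin_cases i <;> simp <;> positivity)
      (by
        by_contra! hcon
        have h0 := hcon 0
        have h1 := hcon 1
        have h2 := hcon 2
        simp only [Matrix.cons_val] at h0 h1 h2
        rcases hlm with h | h
        · exact h (by linarith)
        · exact h (by linarith))
  refine ⟨t * κ, mul_nonneg ht hκ, ?_⟩
  have h0 := hnn 0
  have h1 := hnn 1
  have h2 := hnn 2
  simp only [Matrix.cons_val] at h0 h1 h2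
  have hsum : (g + t * -(l + m)) + (h * e + t * l) + (h * f + t * m) = 1 := by
    linear_combination hgh + h * hef
  have hpt : g • p' + h • (e • q + f • r) + ((t * κ : ℝ) : ℂ) * v
      = (g + t * -(l + m)) • p' + (h * e + t * l) • q + (h * f + t * m) • r := by
    simp only [Complex.real_smul]
    push_cast
    linear_combination -(t : ℂ) * hrel
  rw [hpt]
  fin_cases i <;> simp only [Matrix.cons_val, Fin.zero_eta, Fin.mk_one, Fin.reduceFinMk] at hi
  · rw [hi] at hsum ⊢
    exact Or.inl (Or.inr ⟨_, _, h1, h2, by linarith, by simp⟩)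
  · rw [hi] at hsum ⊢
    exact Or.inr ⟨_, _, h2, h0, by linarith, by simp [add_comm]⟩
  · rw [hi] at hsum ⊢
    exact Or.inl (Or.inl ⟨_, _, h0, h1, by linarith, by simp⟩)

/-- A triangle whose boundary lies in `S` lies in `S`, if `S` is convex along rays from the origin
and avoids some closed ray from the origin. -/
theorem triangle_subset_of_radially_convex {S : Set ℂ} {v : ℂ} (hv : v ≠ 0)
    (hray : ∀ t : ℝ, 0 ≤ t → (t : ℂ) * v ∉ S)
    (hrad : ∀ z : ℂ, ∀ s t : ℝ, 0 < s → s ≤ 1 → 1 ≤ t → (s : ℂ) * z ∈ S → (t : ℂ) * z ∈ S → z ∈ S)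
    {p q r : ℂ} (hpq : segment ℝ p q ⊆ S) (hqr : segment ℝ q r ⊆ S) (hrp : segment ℝ r p ⊆ S) :
    convexHull ℝ {p, q, r} ⊆ S := by
  have hbd : segment ℝ p q ∪ segment ℝ q r ∪ segment ℝ r p ⊆ S :=
    Set.union_subset (Set.union_subset hpq hqr) hrp
  have hcv : Convex ℝ (convexHull ℝ {p, q, r}) := convex_convexHull ℝ _
  have hp : p ∈ convexHull ℝ {p, q, r} := subset_convexHull ℝ _ (by simp)
  have hq : q ∈ convexHull ℝ {p, q, r} := subset_convexHull ℝ _ (by simp)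
  have hr : r ∈ convexHull ℝ {p, q, r} := subset_convexHull ℝ _ (by simp)
  have hbT : segment ℝ p q ∪ segment ℝ q r ∪ segment ℝ r p ⊆ convexHull ℝ {p, q, r} :=
    Set.union_subset (Set.union_subset (hcv.segment_subset hp hq) (hcv.segment_subset hq hr))
      (hcv.segment_subset hr hp)
  have h0 : (0 : ℂ) ∉ convexHull ℝ {p, q, r} := by
    intro h0
    obtain ⟨t, ht, hmem⟩ := exists_add_smul_mem_triangle_boundary hv h0
    rw [zero_add] at hmem
    exact hray t ht (hbd hmem)
  intro z hz
  have hz0 : z ≠ 0 := fun h => h0 (h ▸ hz)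
  obtain ⟨t, ht, htm⟩ := exists_add_smul_mem_triangle_boundary hz0 hz
  obtain ⟨s, hs, hsm⟩ := exists_add_smul_mem_triangle_boundary (neg_ne_zero.mpr hz0) hz
  have hs1 : s < 1 := by
    by_contra! hs1
    -- For s ≥ 1, the origin lies between z and (1 - s)z.
    refine h0 (hcv.segment_subset hz (hbT hsm) ⟨1 - 1 / s, 1 / s, ?_, by positivity, by ring, ?_⟩)
    · rw [sub_nonneg, div_le_one (by linarith)]
      exact hs1
    · have : (s : ℂ) ≠ 0 := by
        norm_cast
        linarith
      simp only [Complex.real_smul]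
      push_cast
      field_simp
      ring
  refine hrad z (1 - s) (1 + t) (by linarith) (by linarith) (by linarith) ?_ ?_
  · convert hbd hsm using 1
    push_cast
    ring
  · convert hbd htm using 1
    push_cast
    ring

/-- Along a path of pairs whose products stay on the real line through `z`, the product passes
through `z` if its coordinates at the ends lie on both sides of `1`. -/
theorem exists_mul_eq_of_real_path {K₁ K₂ : Set ℂ} {z : ℂ} (hz : z ≠ 0) {a b : ℝ → ℂ}
    (ha : ContinuousOn a (Set.Icc 0 1)) (hb : ContinuousOn b (Set.Icc 0 1))
    (haK : ∀ t ∈ Set.Icc (0 : ℝ) 1, a t ∈ K₁) (hbK : ∀ t ∈ Set.Icc (0 : ℝ) 1, b t ∈ K₂)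
    (him : ∀ t ∈ Set.Icc (0 : ℝ) 1, (a t * b t / z).im = 0)
    (h₀ : (a 0 * b 0 / z).re ≤ 1) (h₁ : 1 ≤ (a 1 * b 1 / z).re) :
    z ∈ K₁ * K₂ := by
  have hcont : ContinuousOn (fun t => (a t * b t / z).re) (Set.Icc 0 1) :=
    Complex.continuous_re.comp_continuousOn ((ha.mul hb).div_const z)
  obtain ⟨t, ht, h⟩ := intermediate_value_Icc zero_le_one hcont ⟨h₀, h₁⟩
  have h1 : a t * b t / z = 1 := Complex.ext (by simpa using h) (by simpa using him t ht)
  exact ⟨a t, haK t ht, b t, hbK t ht, (div_eq_one_iff_eq hz).mp h1⟩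

/-- The product of two convex sets of complex numbers is convex along rays from the origin. -/
theorem mem_mul_of_smul_mem_mul {K₁ K₂ : Set ℂ} (hK₁ : Convex ℝ K₁) (hK₂ : Convex ℝ K₂)
    (h0 : (0 : ℂ) ∉ K₁ * K₂) (z : ℂ) (s t : ℝ) (hs : 0 < s) (hs1 : s ≤ 1) (ht1 : 1 ≤ t)
    (hsz : (s : ℂ) * z ∈ K₁ * K₂) (htz : (t : ℂ) * z ∈ K₁ * K₂) : z ∈ K₁ * K₂ := by
  have hz : z ≠ 0 := by
    rintro rfl
    exact h0 (by simpa using hsz)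
  obtain ⟨a, ha, b, hb, hab⟩ := hsz
  obtain ⟨a', ha', b', hb', hab'⟩ := htz
  simp only at hab hab'
  have hst : 0 < s * t := mul_pos hs (by linarith)
  have e₀ : a * b / z = s := by rw [hab]; field_simp
  have e₁ : a' * b' / z = t := by rw [hab']; field_simp
  have hprod : (a' * b / z) * (a * b' / z) = (s * t : ℝ) := by
    push_cast
    rw [← e₀, ← e₁]
    ring
  -- Since uw = st > 0, w is a positive multiple of the conjugate of u: the imaginary parts of the
  -- mixed products have opposite signs and can be balanced.
  set u := a' * b / z with hu
  set w := a * b' / z with hw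
  have hu0 : u ≠ 0 := by
    intro h
    rw [h, zero_mul] at hprod
    exact hst.ne (by exact_mod_cast hprod)
  have hwim : w.im * Complex.normSq u = -(s * t) * u.im := by
    have hre := congrArg Complex.re hprod
    have him := congrArg Complex.im hprod
    simp only [Complex.mul_re, Complex.mul_im, Complex.ofReal_re, Complex.ofReal_im] at hre him
    rw [Complex.normSq_apply]
    linear_combination u.re * him - u.im * hre
  have hn : 0 < Complex.normSq u := Complex.normSq_pos.mpr hu0
  have hcomb : ∀ {K : Set ℂ}, Convex ℝ K → ∀ {x y : ℂ}, x ∈ K → y ∈ K →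
      ∀ σ ∈ Set.Icc (0 : ℝ) 1, ((1 - σ : ℝ) : ℂ) * x + (σ : ℂ) * y ∈ K := by
    intro K hK x y hx hy σ hσ
    have := hK hx hy (sub_nonneg.mpr hσ.2) hσ.1 (by ring)
    simpa only [Complex.real_smul] using this
  by_cases huim : u.im = 0
  · have hwim0 : w.im = 0 := by
      rw [huim, mul_zero] at hwim
      exact (mul_eq_zero.mp hwim).resolve_right hn.ne'
    -- All products are real multiples of z, so moving one factor at a time works; 1 lies between s
    -- and u or between u and t.
    rcases le_total 1 u.re with hle | hle
    · refine exists_mul_eq_of_real_path hz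
        (a := fun τ => ((1 - τ : ℝ) : ℂ) * a + (τ : ℂ) * a') (b := fun _ => b)
        (by fun_prop) (by fun_prop) (fun τ hτ => hcomb hK₁ ha ha' τ hτ) (fun _ _ => hb)
        (fun τ _ => ?_) ?_ ?_
      · have : (((1 - τ : ℝ) : ℂ) * a + (τ : ℂ) * a') * b / z
            = ((1 - τ : ℝ) : ℂ) * (s : ℂ) + (τ : ℂ) * u := by
          rw [← e₀, hu]; ring
        rw [this]
        simp [huim]
      · simpa [e₀] using hs1
      · simpa [← hu] using hle
    · refine exists_mul_eq_of_real_path hz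
        (a := fun _ => a') (b := fun τ => ((1 - τ : ℝ) : ℂ) * b + (τ : ℂ) * b')
        (by fun_prop) (by fun_prop) (fun _ _ => ha') (fun τ hτ => hcomb hK₂ hb hb' τ hτ)
        (fun τ _ => ?_) ?_ ?_
      · have : a' * (((1 - τ : ℝ) : ℂ) * b + (τ : ℂ) * b') / z
            = ((1 - τ : ℝ) : ℂ) * u + (τ : ℂ) * (t : ℂ) := by
          rw [← e₁, hu]; ring
        rw [this]
        simp [huim]
      · simpa [← hu] using hle
      · simpa [e₁] using ht1
  · set N := Complex.normSq u
    -- the weights for which the imaginary parts of the mixed products cancel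
    have hden : ∀ τ ∈ Set.Icc (0 : ℝ) 1, 0 < N * τ + s * t * (1 - τ) := by
      rintro τ ⟨hτ0, hτ1⟩
      rcases hτ0.eq_or_lt with rfl | hpos
      · simpa using hst
      · have := mul_pos hn hpos
        have := mul_nonneg hst.le (sub_nonneg.mpr hτ1)
        linarith
    have hσ : ∀ τ ∈ Set.Icc (0 : ℝ) 1, N * τ / (N * τ + s * t * (1 - τ)) ∈ Set.Icc (0 : ℝ) 1 := by
      intro τ hτ
      have := mul_nonneg hst.le (sub_nonneg.mpr hτ.2)
      refine ⟨div_nonneg (mul_nonneg hn.le hτ.1) (hden τ hτ).le, ?_⟩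
      rw [div_le_one (hden τ hτ)]
      linarith
    have hcont : ContinuousOn (fun τ : ℝ => N * τ / (N * τ + s * t * (1 - τ))) (Set.Icc 0 1) :=
      ContinuousOn.div (by fun_prop) (by fun_prop) fun τ hτ => (hden τ hτ).ne'
    refine exists_mul_eq_of_real_path hz
      (a := fun τ => ((1 - τ : ℝ) : ℂ) * a + (τ : ℂ) * a')
      (b := fun τ => ((1 - N * τ / (N * τ + s * t * (1 - τ)) : ℝ) : ℂ) * b
        + ((N * τ / (N * τ + s * t * (1 - τ)) : ℝ) : ℂ) * b')
      (by fun_prop) ?_ (fun τ hτ => hcomb hK₁ ha ha' τ hτ)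
      (fun τ hτ => hcomb hK₂ hb hb' _ (hσ τ hτ)) (fun τ hτ => ?_) ?_ ?_
    · exact ((Complex.continuous_ofReal.comp_continuousOn (continuousOn_const.sub hcont)).mul
        continuousOn_const).add
        ((Complex.continuous_ofReal.comp_continuousOn hcont).mul continuousOn_const)
    · have hd := (hden τ hτ).ne'
      have hσN : N * τ / (N * τ + s * t * (1 - τ)) * (N * τ + s * t * (1 - τ)) = N * τ :=
        div_mul_cancel₀ _ hd
      set σ := N * τ / (N * τ + s * t * (1 - τ))
      have : (((1 - τ : ℝ) : ℂ) * a + (τ : ℂ) * a') * (((1 - σ : ℝ) : ℂ) * b + (σ : ℂ) * b') / z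
          = (((1 - τ) * (1 - σ) * s + τ * σ * t : ℝ) : ℂ)
            + ((τ * (1 - σ) : ℝ) : ℂ) * u + (((1 - τ) * σ : ℝ) : ℂ) * w := by
        push_cast
        rw [← e₀, ← e₁, hu, hw]; ring
      rw [this]
      simp only [Complex.add_im, Complex.ofReal_im, Complex.im_ofReal_mul]
      apply mul_left_cancel₀ hn.ne'
      linear_combination (1 - τ) * σ * hwim - u.im * hσN
    · simpa [e₀] using hs1
    · simpa [div_self hn.ne', e₁] using ht1

/-- A compact convex set of complex numbers that misses the origin lies, after a rotation, in the
open right half-plane. -/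
theorem exists_forall_re_mul_pos {K : Set ℂ} (hK : IsCompact K) (hK' : Convex ℝ K)
    (h0 : (0 : ℂ) ∉ K) : ∃ c : ℂ, ∀ a ∈ K, 0 < (c * a).re := by
  obtain ⟨f, u, hf0, hf⟩ := geometric_hahn_banach_point_closed hK' hK.isClosed h0
  -- This c represents f as a ↦ Re(ca).
  refine ⟨⟨f 1, -f Complex.I⟩, fun a ha => ?_⟩
  have h := hf a ha
  rw [map_zero] at hf0
  have hfa : f a = a.re * f 1 + a.im * f Complex.I := by
    conv_lhs => rw [← Complex.re_add_im a]
    rw [map_add, ← mul_one (a.re : ℂ), ← Complex.real_smul, ← Complex.real_smul, map_smul,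
      map_smul, smul_eq_mul, smul_eq_mul]
  simp only [Complex.mul_re]
  linarith

/-- The product of two compact convex sets missing the origin misses a closed ray. -/
theorem exists_ray_disjoint_mul {K₁ K₂ : Set ℂ} (hK₁ : IsCompact K₁) (hK₁' : Convex ℝ K₁)
    (hK₂ : IsCompact K₂) (hK₂' : Convex ℝ K₂) (h₁ : (0 : ℂ) ∉ K₁) (h₂ : (0 : ℂ) ∉ K₂) :
    ∃ v : ℂ, v ≠ 0 ∧ ∀ t : ℝ, 0 ≤ t → (t : ℂ) * v ∉ K₁ * K₂ := by
  rcases K₁.eq_empty_or_nonempty with rfl | ⟨a₀, ha₀⟩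
  · exact ⟨1, one_ne_zero, by simp⟩
  rcases K₂.eq_empty_or_nonempty with rfl | ⟨b₀, hb₀⟩
  · exact ⟨1, one_ne_zero, by simp⟩
  obtain ⟨c, hc⟩ := exists_forall_re_mul_pos hK₁ hK₁' h₁
  obtain ⟨d, hd⟩ := exists_forall_re_mul_pos hK₂ hK₂' h₂
  have hc0 : c ≠ 0 := by
    rintro rfl
    simpa using hc a₀ ha₀
  have hd0 : d ≠ 0 := by
    rintro rfl
    simpa using hd b₀ hb₀
  refine ⟨-(c * d)⁻¹, neg_ne_zero.mpr (inv_ne_zero (mul_ne_zero hc0 hd0)), ?_⟩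
  rintro t ht ⟨a, ha, b, hb, hab⟩
  simp only at hab
  have hx := hc a ha
  have hy := hd b hb
  have hxy : (c * a) * (d * b) = ((-t : ℝ) : ℂ) := by
    calc (c * a) * (d * b) = c * d * (a * b) := by ring
      _ = ((-t : ℝ) : ℂ) := by
        rw [hab]
        push_cast
        field_simp
  generalize c * a = x at hx hxy
  generalize d * b = y at hy hxy
  have hre := congrArg Complex.re hxy
  have him := congrArg Complex.im hxy
  simp only [Complex.mul_re, Complex.mul_im, Complex.ofReal_re, Complex.ofReal_im] at hre him
  -- Real part of xy = -t multiplied by the conjugate of x.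
  have key : y.re * (x.re * x.re + x.im * x.im) = -t * x.re := by
    linear_combination x.re * hre + x.im * him
  have : 0 < y.re * (x.re * x.re + x.im * x.im) :=
    mul_pos hy (add_pos_of_pos_of_nonneg (mul_pos hx hx) (mul_self_nonneg _))
  have := mul_nonneg ht hx.le
  linarith

/-- For compact convex sets missing the origin, visibility of a point from the products with
extreme points of the first factor extends to the products with all its points. -/
theorem segment_subset_mul_of_extremePoints {K₁ K₂ : Set ℂ} (hK₁ : IsCompact K₁)
    (hK₁' : Convex ℝ K₁) (hK₂ : IsCompact K₂) (hK₂' : Convex ℝ K₂) (h₁ : (0 : ℂ) ∉ K₁)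
    (h₂ : (0 : ℂ) ∉ K₂) {p b : ℂ} (hb : b ∈ K₂)
    (h : ∀ a ∈ K₁.extremePoints ℝ, segment ℝ p (a * b) ⊆ K₁ * K₂) :
    ∀ a ∈ K₁, segment ℝ p (a * b) ⊆ K₁ * K₂ := by
  have h0 : (0 : ℂ) ∉ K₁ * K₂ := by
    rintro ⟨x, hx, y, hy, hxy⟩
    rcases mul_eq_zero.mp hxy with rfl | rfl
    exacts [h₁ hx, h₂ hy]
  obtain ⟨v, hv, hray⟩ := exists_ray_disjoint_mul hK₁ hK₁' hK₂ hK₂' h₁ h₂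
  set A : Set ℂ := {a | a ∈ K₁ ∧ segment ℝ p (a * b) ⊆ K₁ * K₂} with hA
  have hAconv : Convex ℝ A := by
    rintro x ⟨hx, hxS⟩ y ⟨hy, hyS⟩ α β hα hβ hαβ
    refine ⟨hK₁' hx hy hα hβ hαβ, ?_⟩
    have hside : segment ℝ (x * b) (y * b) ⊆ K₁ * K₂ := by
      rintro _ ⟨α, β, hα, hβ, hαβ, rfl⟩
      exact ⟨α • x + β • y, hK₁' hx hy hα hβ hαβ, b, hb, by
        simp only [add_mul, smul_mul_assoc]⟩
    have hT := triangle_subset_of_radially_convex hv hray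
      (mem_mul_of_smul_mem_mul hK₁' hK₂' h0) hxS hside (by rwa [segment_symm])
    refine ((convex_convexHull ℝ _).segment_subset (subset_convexHull ℝ _ (by simp)) ?_).trans hT
    rw [add_mul, smul_mul_assoc, smul_mul_assoc]
    exact convex_convexHull ℝ _ (subset_convexHull ℝ _ (by simp))
      (subset_convexHull ℝ _ (by simp)) hα hβ hαβ
  have hAclosed : IsClosed A := by
    have hS : IsClosed (K₁ * K₂) := (hK₁.mul hK₂).isClosed
    have : A = K₁ ∩ ⋂ t ∈ Set.Icc (0 : ℝ) 1, {a : ℂ | (1 - t) • p + t • (a * b) ∈ K₁ * K₂} := by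
      ext a
      simp only [hA, segment_eq_image, Set.image_subset_iff, Set.mem_ofPred_eq, Set.mem_inter_iff,
        Set.mem_iInter]
      rfl
    rw [this]
    exact hK₁.isClosed.inter (isClosed_biInter fun t _ => hS.preimage (by fun_prop))
  have hextA : K₁.extremePoints ℝ ⊆ A := fun x hx => by
    rw [hA]
    exact ⟨hx.1, h x hx⟩
  intro a ha
  rw [← closure_convexHull_extremePoints hK₁ hK₁'] at ha
  exact (closure_minimal (convexHull_min hextA hAconv) hAclosed ha).2

/-- The product of a convex set containing the origin with any nonempty set is star-shaped. -/
theorem isStarShaped_mul_of_zero_mem {K₁ K₂ : Set ℂ} (hK₁ : Convex ℝ K₁) (h₁ : (0 : ℂ) ∈ K₁)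
    (hK₂ : K₂.Nonempty) : IsStarShaped (K₁ * K₂) := by
  obtain ⟨b₀, hb₀⟩ := hK₂
  refine ⟨0, ⟨0, h₁, b₀, hb₀, by simp⟩, ?_⟩
  rintro _ ⟨a, ha, b, hb, rfl⟩ α β hα hβ hαβ
  refine ⟨α • 0 + β • a, hK₁ h₁ ha hα hβ hαβ, b, hb, ?_⟩
  simp [mul_assoc]

theorem theorem6p1 (K₁ K₂ : Set ℂ)
    (hK₁ : IsCompact K₁) (hK₁' : Convex ℝ K₁) (hK₂ : IsCompact K₂) (hK₂' : Convex ℝ K₂) :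
    IsStarShaped (K₁ * K₂) ↔
      ∃ p ∈ K₁ * K₂, ∀ a ∈ K₁.extremePoints ℝ, ∀ b ∈ K₂.extremePoints ℝ,
        segment ℝ p (a * b) ⊆ K₁ * K₂ := by
  constructor
  · rintro ⟨p, hp, hstar⟩
    exact ⟨p, hp, fun a ha b hb => hstar.segment_subset (Set.mul_mem_mul ha.1 hb.1)⟩
  · rintro ⟨p, hp, h⟩
    by_cases h₁ : (0 : ℂ) ∈ K₁
    · exact isStarShaped_mul_of_zero_mem hK₁' h₁ (Set.Nonempty.of_mul_right ⟨p, hp⟩)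
    by_cases h₂ : (0 : ℂ) ∈ K₂
    · rw [mul_comm]
      exact isStarShaped_mul_of_zero_mem hK₂' h₂ (Set.Nonempty.of_mul_left ⟨p, hp⟩)
    refine ⟨p, hp, starConvex_iff_segment_subset.mpr ?_⟩
    rintro _ ⟨a, ha, b, hb, rfl⟩
    -- With b extreme, a first ranges over all of K₁; this a is then fixed while b is freed.
    have hext : ∀ b ∈ K₂.extremePoints ℝ, segment ℝ p (b * a) ⊆ K₂ * K₁ := fun b hb => by
      rw [mul_comm b, mul_comm K₂]
      exact segment_subset_mul_of_extremePoints hK₁ hK₁' hK₂ hK₂' h₁ h₂ hb.1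
        (fun a ha => h a ha b hb) a ha
    have := segment_subset_mul_of_extremePoints hK₂ hK₂' hK₁ hK₁' h₂ h₁ ha hext b hb
    rwa [mul_comm b, mul_comm K₂] at this
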